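/- \textbf{Setting.} Let $0<r<1/2$ and $0<2\omega<1-2r$. Let $\phi_j$, $j\ge 1$, be an orthonormal system in the real space $L_2(0,1)$ with norm $\|\cdot\|$. For a signal $S\in L_2(0,1)$ observed in Gaussian white noise of level $\varepsilon>0$, put $y_j=\theta_j+\varepsilon\xi_j$, $j\ge1$, where $\theta_j=\int_0^1 S\phi_j\,dt$ and the $\xi_j$ are independent standard normal variables. Let $\varkappa_{\varepsilon j}^2\ge 0$ ($\varepsilon>0$, $j\ge1$) be weights with $\rho_\varepsilon^2=\sum_j\varkappa_{\varepsilon j}^2<\infty$, and put $$A_\varepsilon=\varepsilon^{-4}\sum_{j\ge1}\varkappa_{\varepsilon j}^4,\quad k_\varepsilon=\sup\Bigl\{k:\sum_{j<k}\varkappa_{\varepsilon j}^2\le \tfrac12\rho_\varepsilon^2\Bigr\},\quad \varkappa_\varepsilon^2=\varkappa_{\varepsilon k_\varepsilon}^2 .$$ Relations $\asymp$ between functions of $\varepsilon$ are meant as $\varepsilon\to0$, those between sequences as $i\to\infty$, and $[a]$ is the integer part of $a$. Assume $k_\varepsilon\asymp\varepsilon^{-4+8r+4\omega}$ and: A1.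 For every $\varepsilon>0$ the sequence $\varkappa_{\varepsilon j}^2$, $j\ge 1$, is decreasing (not necessarily strictly). A2. There are constants $0<C_1<C_2$ with $C_1<A_\varepsilon<C_2$ for all $\varepsilon>0$. A3. There are $C_1>0$ and $\lambda>1$ such that $\varkappa^2_{\varepsilon,[(1+\delta)k_\varepsilon]}<C_1(1+\delta)^{-\lambda}\varkappa_\varepsilon^2$ for all $\delta>0$ and $\varepsilon>0$. A4. $\varkappa_{\varepsilon1}^2\asymp\varkappa_\varepsilon^2$; and for every $c>1$ there is $C>0$ with $\varkappa^2_{\varepsilon,[ck_\varepsilon]}\ge C\varkappa_\varepsilon^2$ for all $\varepsilon>0$. \textbf{Tests.} Consider the statistic $T_\varepsilon=\varepsilon^{-2}\sum_{j}\varkappa_{\varepsilon j}^2y_j^2-\rho_\varepsilon^2$ and the tests $L_\varepsilon=\mathbf 1\{A_\varepsilon^{-1/2}T_\varepsilon>x_\varepsilon\}$ with real critical values $x_\varepsilon$. Let $\alpha(L_\varepsilon)=\mathbf E_0L_\varepsilon$ and $\beta(L_\varepsilon,S)=\mathbf E_S(1-L_\varepsilon)$ be the error probabilities. \textbf{Definitions.}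 A family of alternatives $S_\varepsilon\in L_2(0,1)$, $\varepsilon>0$, is \emph{$\varepsilon^{-2\omega}$-LD consistent} if for all such tests with $\varepsilon^{4\omega}\log\alpha(L_\varepsilon)\to0$ as $\varepsilon\to 0$ there is $c>0$ with $|\log\beta(L_\varepsilon,S_\varepsilon)|\ge c\,\varepsilon^{-4\omega}$ for all sufficiently small $\varepsilon$ (where $|\log 0|=\infty$). For a sequence of alternatives $S_{1\varepsilon_i}$ at noise levels $\varepsilon_i>0$, $\varepsilon_i\to0$, consistency is defined in the same way, with tests $L_{\varepsilon_i}$ and the limit $i\to\infty$; the sequence is \emph{LD-inconsistent} if none of its subsequences is $\varepsilon^{-2\omega}$-LD consistent. A family $S_\varepsilon$ with $\|S_\varepsilon\|\asymp\varepsilon^{2r}$ is \emph{purely $\varepsilon^{-2\omega}$-LD consistent} if it is $\varepsilon^{-2\omega}$-LD consistent and there are no $c_1>0$, $\varepsilon_i\to0$ ($\varepsilon_i>0$) and LD-inconsistent sequence $S_{1\varepsilon_i}$ such that, for all $i$, $S_{1\varepsilon_i}$ is orthogonal to $S_{\varepsilon_i}-S_{1\varepsilon_i}$ and $\|S_{1\varepsilon_i}\|>c_1\varepsilon_i^{2r}$.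 \textbf{Theorem.} Let $S_\varepsilon\in L_2(0,1)$, $\varepsilon>0$, satisfy $\|S_\varepsilon\|\asymp\varepsilon^{2r}$. Then the family $S_\varepsilon$ is purely $\varepsilon^{-2\omega}$-LD consistent if and only if, for every sequence $\varepsilon_i\to0$, $\varepsilon_i>0$, and every LD-inconsistent sequence of alternatives $S_{1\varepsilon_i}$ with $\|S_{1\varepsilon_i}\|\asymp\varepsilon_i^{2r}$, $$\|S_{\varepsilon_i}+S_{1\varepsilon_i}\|^2=\|S_{\varepsilon_i}\|^2+\|S_{1\varepsilon_i}\|^2+o(\varepsilon_i^{4r})\qquad (i\to\infty).$$ -/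

import Mathlib

open Filter Topology MeasureTheory ProbabilityTheory Asymptotics

noncomputable section

namespace SignalDetection

/-- The Hilbert space `L₂(0,1)` of real square-integrable signals. -/
abbrev Signal : Type := Lp ℝ 2 (volume.restrict (Set.Ioo (0 : ℝ) 1))

/-- The Fourier coefficient `θ_j = ∫ S φ_j` of a signal. -/
def coeff (φ : ℕ+ → Signal) (S : Signal) (j : ℕ+) : ℝ := inner ℝ (φ j) S

/-- The law of the observed coefficients `y_j = θ_j + ε ξ_j`, `j ≥ 1`, with `ξ_j` independent
standard normal: the `y_j` are independent, `y_j` being normal with mean `θ_j` and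
variance `ε²`. -/
def obsLaw (φ : ℕ+ → Signal) (ε : ℝ) (S : Signal) : Measure (ℕ+ → ℝ) :=
  Measure.infinitePi fun j => gaussianReal (coeff φ S j) (Real.toNNReal (ε ^ 2))

/-! The weights are `κ ε j ^ 2` with `j ≥ 1`; the value `κ ε 0` is never used. -/

/-- `ρ_ε² = ∑_{j ≥ 1} κ_{εj}²`. -/
def rhoSq (κ : ℝ → ℕ → ℝ) (ε : ℝ) : ℝ := ∑' j : ℕ+, κ ε j ^ 2

/-- `A_ε = ε⁻⁴ ∑_{j ≥ 1} κ_{εj}⁴`. -/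
def Anorm (κ : ℝ → ℕ → ℝ) (ε : ℝ) : ℝ := (ε ^ 4)⁻¹ * ∑' j : ℕ+, κ ε j ^ 4

/-- `k_ε = sup {k : ∑_{1 ≤ j < k} κ_{εj}² ≤ ρ_ε² / 2}`. -/
def kIndex (κ : ℝ → ℕ → ℝ) (ε : ℝ) : ℕ :=
  sSup {k : ℕ | ∑ j ∈ Finset.Ico 1 k, κ ε j ^ 2 ≤ 1 / 2 * rhoSq κ ε}

/-- `κ_ε² = κ_{ε k_ε}²`. -/
def kappaSq (κ : ℝ → ℕ → ℝ) (ε : ℝ) : ℝ := κ ε (kIndex κ ε) ^ 2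

/-- A1: for every `ε > 0` the sequence `κ_{εj}²`, `j ≥ 1`, is decreasing. -/
def CondA1 (κ : ℝ → ℕ → ℝ) : Prop :=
  ∀ ε : ℝ, 0 < ε → ∀ i j : ℕ, 1 ≤ i → i ≤ j → κ ε j ^ 2 ≤ κ ε i ^ 2

/-- A2: `A_ε` lies between two positive constants. -/
def CondA2 (κ : ℝ → ℕ → ℝ) : Prop :=
  ∃ C₁ C₂ : ℝ, 0 < C₁ ∧ ∀ ε : ℝ, 0 < ε → C₁ < Anorm κ ε ∧ Anorm κ ε < C₂

/-- A3: `κ²_{ε,[(1+δ)k_ε]} < C₁ (1+δ)^{-λ} κ_ε²` for all `δ > 0` and `ε > 0`. -/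
def CondA3 (κ : ℝ → ℕ → ℝ) : Prop :=
  ∃ C₁ lam : ℝ, 0 < C₁ ∧ 1 < lam ∧ ∀ δ : ℝ, 0 < δ → ∀ ε : ℝ, 0 < ε →
    κ ε ⌊(1 + δ) * (kIndex κ ε : ℝ)⌋₊ ^ 2 < C₁ * (1 + δ) ^ (-lam) * kappaSq κ ε

/-- A4: `κ_{ε1}² ≍ κ_ε²` as `ε → 0`, and for every `c > 1` there is `C > 0` with
`κ²_{ε,[c k_ε]} ≥ C κ_ε²` for all `ε > 0`. -/
def CondA4 (κ : ℝ → ℕ → ℝ) : Prop :=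
  ((fun ε : ℝ => κ ε 1 ^ 2) =Θ[𝓝[>] 0] fun ε : ℝ => kappaSq κ ε) ∧
  ∀ c : ℝ, 1 < c → ∃ C : ℝ, 0 < C ∧ ∀ ε : ℝ, 0 < ε →
    C * kappaSq κ ε ≤ κ ε ⌊c * (kIndex κ ε : ℝ)⌋₊ ^ 2

/-- The statistic `T_ε(y) = ε⁻² ∑ κ_{εj}² y_j² - ρ_ε²`. -/
def stat (κ : ℝ → ℕ → ℝ) (ε : ℝ) (y : ℕ+ → ℝ) : ℝ :=
  (ε ^ 2)⁻¹ * ∑' j : ℕ+, κ ε j ^ 2 * y j ^ 2 - rhoSq κ ε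

/-- The rejection region of the test `1{A_ε^{-1/2} T_ε > x}`. -/
def rejection (κ : ℝ → ℕ → ℝ) (ε x : ℝ) : Set (ℕ+ → ℝ) :=
  {y | x < (Real.sqrt (Anorm κ ε))⁻¹ * stat κ ε y}

/-- Type I error probability of the test with critical value `x`. -/
def typeI (φ : ℕ+ → Signal) (κ : ℝ → ℕ → ℝ) (ε x : ℝ) : ℝ :=
  (obsLaw φ ε 0).real (rejection κ ε x)

/-- Type II error probability, at the alternative `S`, of the test with critical value `x`. -/
def typeII (φ : ℕ+ → Signal) (κ : ℝ → ℕ → ℝ) (ε x : ℝ) (S : Signal) : ℝ :=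
  (obsLaw φ ε S).real (rejection κ ε x)ᶜ

/-- `ε^{-2ω}`-LD consistency of the alternatives `S i`, observed at noise level `e i`, along the
filter `l`. Write `R i = (e i)^{-2ω}`. For all critical values `x i` such that
`R⁻² log α → 0`, one has `|log β| = Ω(R²)`. The last relation is `c R² ≤ |log β|` with a
constant `c > 0`; as `0 ≤ β ≤ 1`, it is written `β ≤ exp (-c R²)`, which treats `β = 0`
(that is, `|log β| = ∞`) correctly.
For a family `S_ε`, `ε > 0`, the filter is `𝓝[>] 0` and `e = id`; for a sequence it is `atTop`. -/
def LDConsistent {ι : Type} (φ : ℕ+ → Signal) (κ : ℝ → ℕ → ℝ) (ω : ℝ)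
    (l : Filter ι) (e : ι → ℝ) (S : ι → Signal) : Prop :=
  ∀ x : ι → ℝ,
    Tendsto (fun i => ((e i ^ (-2 * ω)) ^ 2)⁻¹ * Real.log (typeI φ κ (e i) (x i))) l (𝓝 0) →
    ∃ c : ℝ, 0 < c ∧ ∀ᶠ i in l,
      typeII φ κ (e i) (x i) (S i) ≤ Real.exp (-(c * (e i ^ (-2 * ω)) ^ 2))

/-- An `ε^{-2ω}`-LD inconsistent sequence: consistency fails along every subsequence. -/
def LDInconsistent (φ : ℕ+ → Signal) (κ : ℝ → ℕ → ℝ) (ω : ℝ)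
    (e : ℕ → ℝ) (S : ℕ → Signal) : Prop :=
  ∀ n : ℕ → ℕ, StrictMono n → ¬ LDConsistent φ κ ω atTop (e ∘ n) (S ∘ n)

/-- Pure `ε^{-2ω}`-LD consistency of the family `S_ε`, `ε > 0`. -/
def PurelyLDConsistent (φ : ℕ+ → Signal) (κ : ℝ → ℕ → ℝ) (r ω : ℝ)
    (S : ℝ → Signal) : Prop :=
  LDConsistent φ κ ω (𝓝[>] 0) id S ∧
  ¬ ∃ (e : ℕ → ℝ) (S₁ : ℕ → Signal) (c₁ : ℝ),
      (∀ i, 0 < e i) ∧ Tendsto e atTop (𝓝 0) ∧ LDInconsistent φ κ ω e S₁ ∧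
      (∀ i, inner ℝ (S₁ i) (S (e i) - S₁ i) = 0) ∧
      0 < c₁ ∧ ∀ i, c₁ * e i ^ (2 * r) < ‖S₁ i‖

end SignalDetection

end

open SignalDetection

/-!
Under `S` the statistic is a weighted sum of squares of independent normal variables, so its
exponential moments are explicit. When no single weight dominates, Chernoff bounds and the second
moment method show that consistency along a sequence means that the signal-to-noise ratio is at
least of order `ε^{-2ω}`, and inconsistency that it is `o(ε^{-2ω})`. The ratio is a quadratic
form in the signal, hence bounded multiples of an inconsistent sequence are inconsistent.

The deviation from additivity of the squared norm is the cross term `2⟪S, S₁⟫`. The projection of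
`S` onto the line spanned by an inconsistent `S₁` with `‖S₁‖ ≍ ε^{2r}` is a bounded multiple
of `S₁`, so it is inconsistent, and it is orthogonal to its difference from `S`. Pure consistency
says that such components of `S` have norm `o(ε^{2r})`, which is to say
`⟪S, S₁⟫ = o(ε^{4r})`.
-/

namespace SignalDetection

open scoped NNReal ENNReal

/-! ### Fatou's lemma and the second moment method -/

theorem integrable_and_integral_le_of_tendsto {Ω ι : Type*} {mΩ : MeasurableSpace Ω}
    {μ : Measure Ω} {l : Filter ι} [l.NeBot] [l.IsCountablyGenerated] {f : ι → Ω → ℝ} {g : Ω → ℝ}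
    {b : ι → ℝ} {B : ℝ} (hf : ∀ i, Integrable (f i) μ) (hf0 : ∀ i, 0 ≤ f i)
    (hfg : ∀ᵐ ω ∂μ, Tendsto (fun i => f i ω) l (𝓝 (g ω))) (hfb : ∀ i, ∫ ω, f i ω ∂μ ≤ b i)
    (hb : Tendsto b l (𝓝 B)) : Integrable g μ ∧ ∫ ω, g ω ∂μ ≤ B := by
  have hg : AEStronglyMeasurable g μ :=
    aestronglyMeasurable_of_tendsto_ae l (fun i => (hf i).aestronglyMeasurable) hfg
  have hg0 : 0 ≤ᵐ[μ] g := by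
    filter_upwards [hfg] with ω hω using ge_of_tendsto' hω fun i => hf0 i ω
  have hB : 0 ≤ B := ge_of_tendsto' hb fun i => (integral_nonneg (hf0 i)).trans (hfb i)
  have hle : ∫⁻ ω, ENNReal.ofReal (g ω) ∂μ ≤ ENNReal.ofReal B :=
    calc ∫⁻ ω, ENNReal.ofReal (g ω) ∂μ
        = ∫⁻ ω, liminf (fun i => ENNReal.ofReal (f i ω)) l ∂μ :=
          lintegral_congr_ae <| by
            filter_upwards [hfg] with ω hω using (ENNReal.tendsto_ofReal hω).liminf_eq.symm
      _ ≤ liminf (fun i => ∫⁻ ω, ENNReal.ofReal (f i ω) ∂μ) l :=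
          lintegral_liminf_le' fun i => (hf i).aemeasurable.ennreal_ofReal
      _ ≤ liminf (fun i => ENNReal.ofReal (b i)) l := by
          refine liminf_le_liminf (Eventually.of_forall fun i => ?_)
          rw [← ofReal_integral_eq_lintegral_ofReal (hf i) (ae_of_all _ (hf0 i))]
          exact ENNReal.ofReal_le_ofReal (hfb i)
      _ = ENNReal.ofReal B := (ENNReal.tendsto_ofReal hb).liminf_eq
  have hint : Integrable g μ :=
    ⟨hg, (hasFiniteIntegral_iff_ofReal hg0).2 (hle.trans_lt ENNReal.ofReal_lt_top)⟩
  refine ⟨hint, (ENNReal.ofReal_le_ofReal_iff hB).1 ?_⟩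
  rwa [ofReal_integral_eq_lintegral_ofReal hint hg0]

theorem sq_setIntegral_le {Ω : Type*} {mΩ : MeasurableSpace Ω} {μ : Measure Ω}
    [IsFiniteMeasure μ] {Z : Ω → ℝ} (hZ : MemLp Z 2 μ) (A : Set Ω) :
    (∫ ω in A, Z ω ∂μ) ^ 2 ≤ (∫ ω, Z ω ^ 2 ∂μ) * μ.real A := by
  have hZ1 : IntegrableOn Z A μ := (hZ.integrable one_le_two).integrableOn
  have hZ2 : IntegrableOn (fun ω => Z ω ^ 2) A μ := hZ.integrable_sq.integrableOn
  have hquad (a : ℝ) :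
      0 ≤ μ.real A * (a * a) + -2 * (∫ ω in A, Z ω ∂μ) * a + ∫ ω in A, Z ω ^ 2 ∂μ := by
    calc 0 ≤ ∫ ω in A, (Z ω - a) ^ 2 ∂μ := integral_nonneg fun ω => sq_nonneg _
      _ = ∫ ω in A, (Z ω ^ 2 + (-2 * a) * Z ω + a * a) ∂μ := by congr with ω; ring
      _ = _ := by
        have hlin := hZ1.const_mul (-2 * a)
        have hsum : IntegrableOn (fun ω => Z ω ^ 2 + -2 * a * Z ω) A μ := hZ2.add hlin
        rw [integral_add hsum (integrable_const _), integral_add hZ2 hlin,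
          integral_const_mul, setIntegral_const, smul_eq_mul]
        ring
  have hdiscrim := discrim_le_zero hquad
  have hmono : ∫ ω in A, Z ω ^ 2 ∂μ ≤ ∫ ω, Z ω ^ 2 ∂μ :=
    setIntegral_le_integral hZ.integrable_sq (ae_of_all _ fun ω => sq_nonneg _)
  have := mul_le_mul_of_nonneg_right hmono (measureReal_nonneg (μ := μ) (s := A))
  rw [discrim] at hdiscrim
  linarith

theorem paley_zygmund {Ω : Type*} {mΩ : MeasurableSpace Ω} {μ : Measure Ω}
    [IsProbabilityMeasure μ] {Z : Ω → ℝ} {c : ℝ} (hZ : MemLp Z 2 μ) (hc : 0 ≤ c)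
    (hcZ : c ≤ ∫ ω, Z ω ∂μ) :
    (∫ ω, Z ω ∂μ - c) ^ 2 ≤ (∫ ω, Z ω ^ 2 ∂μ) * μ.real {ω | c < Z ω} := by
  set A := {ω | c < Z ω}
  have hZ1 : Integrable Z μ := hZ.integrable one_le_two
  have hAm : NullMeasurableSet A μ := nullMeasurableSet_lt aemeasurable_const hZ1.aemeasurable
  have hAE : ∫ ω in A, Z ω ∂μ ≥ ∫ ω, Z ω ∂μ - c := by
    have hcompl : ∫ ω in Aᶜ, Z ω ∂μ ≤ c := by
      calc ∫ ω in Aᶜ, Z ω ∂μ ≤ ∫ _ in Aᶜ, c ∂μ :=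
            setIntegral_mono_on₀ hZ1.integrableOn (integrable_const c).integrableOn hAm.compl
              fun ω hω => not_lt.1 hω
        _ = μ.real Aᶜ * c := by rw [setIntegral_const, smul_eq_mul]
        _ ≤ c := mul_le_of_le_one_left hc measureReal_le_one
    linarith [integral_add_compl₀ hAm hZ1]
  exact (pow_le_pow_left₀ (sub_nonneg.2 hcZ) hAE 2).trans (sq_setIntegral_le hZ A)

theorem sq_mgf_le_mul_measureReal {Ω : Type*} {mΩ : MeasurableSpace Ω} {μ : Measure Ω}
    [IsProbabilityMeasure μ] {X : Ω → ℝ} {t x : ℝ} (ht : 0 < t)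
    (hint : Integrable (fun ω => Real.exp (t * X ω)) μ)
    (hint2 : Integrable (fun ω => Real.exp (2 * t * X ω)) μ)
    (hx : 2 * Real.exp (t * x) ≤ mgf X μ t) :
    mgf X μ t ^ 2 ≤ 4 * (mgf X μ (2 * t) * μ.real {ω | x < X ω}) := by
  have hsq (ω : Ω) : Real.exp (t * X ω) ^ 2 = Real.exp (2 * t * X ω) := by
    rw [← Real.exp_nat_mul]; push_cast; ring_nf
  have hZ : MemLp (fun ω => Real.exp (t * X ω)) 2 μ :=
    (memLp_two_iff_integrable_sq hint.aestronglyMeasurable).2 (by simpa only [hsq] using hint2)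
  have hpz := paley_zygmund hZ (Real.exp_pos (t * x)).le
    (by rw [mgf] at hx; linarith [Real.exp_pos (t * x)])
  simp only [hsq, Real.exp_lt_exp, mul_lt_mul_iff_right₀ ht] at hpz
  change (mgf X μ t - _) ^ 2 ≤ mgf X μ (2 * t) * _ at hpz
  nlinarith [Real.exp_pos (t * x)]

/-! ### Exponential moments of the square of a normal variable -/

section GaussianSquare

variable {v : ℝ≥0} {b : ℝ}

theorem gaussianPDFReal_mul_exp_sq (m : ℝ) (hv : v ≠ 0) (hb : 2 * b < 1) (y : ℝ) :
    gaussianPDFReal m v y * Real.exp (b * (y ^ 2 / v - 1)) =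
      Real.exp (-b) * (√(1 - 2 * b))⁻¹ * Real.exp (b / (1 - 2 * b) * (m ^ 2 / v)) *
        gaussianPDFReal (m / (1 - 2 * b)) (v / (1 - 2 * b).toNNReal) y := by
  obtain ⟨q, hq⟩ : ∃ q, q = 1 - 2 * b := ⟨_, rfl⟩
  have hq0 : 0 < q := by linarith
  obtain rfl : b = (1 - q) / 2 := by linarith
  rw [← hq]
  have hsqrt : √(2 * Real.pi * (v / q)) = √(2 * Real.pi * v) / √q := by
    rw [← Real.sqrt_div (by positivity), mul_div_assoc]
  have hexp : Real.exp (-(y - m) ^ 2 / (2 * v)) * Real.exp ((1 - q) / 2 * (y ^ 2 / v - 1)) =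
      Real.exp (-((1 - q) / 2)) * Real.exp ((1 - q) / 2 / q * (m ^ 2 / v)) *
        Real.exp (-(y - m / q) ^ 2 / (2 * (v / q))) := by
    simp only [← Real.exp_add]
    congr 1
    field_simp
    ring
  simp only [gaussianPDFReal, NNReal.coe_div, Real.coe_toNNReal q hq0.le]
  rw [hsqrt, mul_assoc, hexp]
  have : √q ≠ 0 := (Real.sqrt_pos.2 hq0).ne'
  field_simp

theorem mgf_sq_gaussianReal (m : ℝ) (hv : v ≠ 0) (hb : 2 * b < 1) :
    mgf (fun y => y ^ 2 / v - 1) (gaussianReal m v) b =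
      Real.exp (-b) * (√(1 - 2 * b))⁻¹ * Real.exp (b / (1 - 2 * b) * (m ^ 2 / v)) := by
  have hq : (1 - 2 * b).toNNReal ≠ 0 := (Real.toNNReal_pos.2 (by linarith)).ne'
  rw [mgf, integral_gaussianReal_eq_integral_smul hv]
  simp only [smul_eq_mul, gaussianPDFReal_mul_exp_sq m hv hb]
  rw [integral_const_mul, integral_gaussianPDFReal_eq_one _ (div_ne_zero hv hq), mul_one]

theorem mgf_sq_gaussianReal_eq_exp (m : ℝ) (hv : v ≠ 0) (hb : 2 * b < 1) :
    mgf (fun y => y ^ 2 / v - 1) (gaussianReal m v) b =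
      Real.exp (-b - Real.log (1 - 2 * b) / 2 + b / (1 - 2 * b) * (m ^ 2 / v)) := by
  have hq : 0 < 1 - 2 * b := by linarith
  rw [mgf_sq_gaussianReal m hv hb, Real.exp_add, sub_eq_add_neg (-b), Real.exp_add,
    Real.exp_neg (Real.log _ / 2), Real.exp_half, Real.exp_log hq]

theorem integrable_exp_sq_gaussianReal (m : ℝ) (hv : v ≠ 0) (hb : 2 * b < 1) :
    Integrable (fun y => Real.exp (b * (y ^ 2 / v - 1))) (gaussianReal m v) :=
  mgf_pos_iff.1 <| by rw [mgf_sq_gaussianReal_eq_exp m hv hb]; exact Real.exp_pos _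

theorem mgf_sq_gaussianReal_le (m : ℝ) (hv : v ≠ 0) (hb : |b| ≤ 1 / 8) :
    mgf (fun y => y ^ 2 / v - 1) (gaussianReal m v) b ≤
      Real.exp (3 * b ^ 2 + (b + |b| / 2) * (m ^ 2 / v)) := by
  have hb_upper : b ≤ 1 / 8 := (le_abs_self b).trans hb
  have hlog : -(6 * b ^ 2) ≤ 2 * b + Real.log (1 - 2 * b) := by
    have habs : |2 * b| = 2 * |b| := by rw [abs_mul, abs_two]
    have h := Real.abs_log_sub_add_sum_range_le (x := 2 * b) (by linarith) 1
    simp only [Finset.range_one, Finset.sum_singleton, Nat.cast_zero, zero_add, pow_one,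
      div_one, one_add_one_eq_two] at h
    refine (abs_le.1 (h.trans ?_)).1
    rw [div_le_iff₀ (by linarith), sq_abs, habs]
    nlinarith [sq_nonneg b]
  have hcoef : b / (1 - 2 * b) ≤ b + |b| / 2 := by
    rw [div_le_iff₀ (by linarith)]
    nlinarith [abs_nonneg b, sq_abs b, le_abs_self b, neg_abs_le b]
  rw [mgf_sq_gaussianReal_eq_exp m hv (by linarith)]
  exact Real.exp_le_exp.2
    (add_le_add (by linarith) (mul_le_mul_of_nonneg_right hcoef (by positivity)))

theorem exp_sq_le_mgf_sq_gaussianReal (hv : v ≠ 0) (hb0 : 0 ≤ b) (hb : 2 * b < 1) :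
    Real.exp (b ^ 2) ≤ mgf (fun y => y ^ 2 / v - 1) (gaussianReal 0 v) b := by
  have hlog : 2 * b + (2 * b) ^ 2 / 2 ≤ -Real.log (1 - 2 * b) := by
    have hsum := sum_le_hasSum (Finset.range 2) (fun i _ => by positivity)
      (Real.hasSum_pow_div_log_of_abs_lt_one (x := 2 * b) (by rwa [abs_of_nonneg (by linarith)]))
    simpa [Finset.sum_range_succ, one_add_one_eq_two] using hsum
  rw [mgf_sq_gaussianReal_eq_exp 0 hv hb, Real.exp_le_exp, zero_pow two_ne_zero, zero_div,
    mul_zero, add_zero]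
  linarith

end GaussianSquare

/-! ### Weighted sums of squares of independent normal variables -/

/-- The law of a family of independent normal variables with means `m j` and common variance
`v`. -/
noncomputable def gaussianSeq {ι : Type*} (m : ι → ℝ) (v : ℝ≥0) : Measure (ι → ℝ) :=
  Measure.infinitePi fun j => gaussianReal (m j) v

/-- The quadratic statistic with weights `w`, centred at its mean under `gaussianSeq 0 v`. -/
noncomputable def quadStat {ι : Type*} (w : ι → ℝ) (v : ℝ≥0) (y : ι → ℝ) : ℝ :=
  (v : ℝ)⁻¹ * ∑' j, w j * y j ^ 2 - ∑' j, w j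

/-- The mean of the statistic `quadStat w v` under `gaussianSeq m v`. -/
noncomputable def meanShift {ι : Type*} (w m : ι → ℝ) (v : ℝ≥0) : ℝ :=
  (v : ℝ)⁻¹ * ∑' j, w j * m j ^ 2

section QuadStat

variable {ι : Type*} {w m : ι → ℝ} {v : ℝ≥0} {t : ℝ}

instance : IsProbabilityMeasure (gaussianSeq m v) := by
  unfold gaussianSeq; infer_instance

theorem measurePreserving_eval_gaussianSeq (j : ι) :
    MeasurePreserving (Function.eval j) (gaussianSeq m v) (gaussianReal (m j) v) :=
  measurePreserving_eval_infinitePi _ j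

theorem summable_sq_of_nonneg (hw : Summable w) (hw0 : ∀ j, 0 ≤ w j) :
    Summable fun j => w j ^ 2 := by
  simp only [sq]
  exact (hw.mul_of_nonneg hw hw0 hw0).comp_injective (i := fun j => (j, j))
    fun _ _ h => congrArg Prod.fst h

theorem integral_sq_gaussianReal (m : ℝ) (v : ℝ≥0) :
    ∫ x, x ^ 2 ∂gaussianReal m v = m ^ 2 + v := by
  have hvar := variance_eq_sub (memLp_id_gaussianReal (μ := m) (v := v) 2)
  simp only [variance_id_gaussianReal, Pi.pow_apply, id_eq, integral_id_gaussianReal] at hvar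
  linarith

theorem integral_mul_sq_gaussianSeq (j : ι) (c : ℝ) :
    ∫ y, c * y j ^ 2 ∂gaussianSeq m v = c * (m j ^ 2 + v) := by
  rw [← integral_sq_gaussianReal, ← integral_const_mul]
  have hpres := measurePreserving_eval_gaussianSeq (m := m) (v := v) j
  rw [← hpres.map_eq, integral_map hpres.aemeasurable (by fun_prop)]

theorem integrable_mul_sq_gaussianSeq (j : ι) (c : ℝ) :
    Integrable (fun y => c * y j ^ 2) (gaussianSeq m v) :=
  ((measurePreserving_eval_gaussianSeq j).integrable_comp_of_integrable
    (memLp_id_gaussianReal 2).integrable_sq).const_mul c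

theorem ae_summable_mul_sq [Countable ι] (hw : Summable w) (hw0 : ∀ j, 0 ≤ w j)
    (hm : Summable fun j => w j * m j ^ 2) :
    ∀ᵐ y ∂gaussianSeq m v, Summable fun j => w j * y j ^ 2 := by
  have hnonneg (y : ι → ℝ) (j : ι) : 0 ≤ w j * y j ^ 2 := mul_nonneg (hw0 j) (sq_nonneg _)
  have hnorm (j : ι) : eLpNorm (fun y => w j * y j ^ 2) 1 (gaussianSeq m v) =
      ENNReal.ofReal (w j * m j ^ 2 + w j * v) := by
    rw [← mul_add, ← integral_mul_sq_gaussianSeq,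
      ofReal_integral_eq_lintegral_ofReal (integrable_mul_sq_gaussianSeq j _)
        (ae_of_all _ fun y => hnonneg y j), eLpNorm_one_eq_lintegral_enorm]
    simp only [Real.enorm_eq_ofReal (hnonneg _ j)]
  have hae := summable_norm_of_tsum_eLpNorm_ne_top (μ := gaussianSeq m v) le_rfl
    (f := fun j y => w j * y j ^ 2)
    (fun j => (integrable_mul_sq_gaussianSeq j _).aestronglyMeasurable)
    (by simpa only [hnorm] using (hm.add (hw.mul_right (v : ℝ))).tsum_ofReal_ne_top)
  filter_upwards [hae] with y hy using hy.of_norm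

theorem hasSum_quadStat (hw : Summable w) {y : ι → ℝ} (hy : Summable fun j => w j * y j ^ 2) :
    HasSum (fun j => w j * (y j ^ 2 / v - 1)) (quadStat w v y) := by
  refine ((hy.hasSum.mul_left (v : ℝ)⁻¹).sub hw.hasSum).congr_fun fun j => ?_
  ring

theorem sum_mul_sub_one_le_quadStat_add (hw0 : ∀ j, 0 ≤ w j) {y : ι → ℝ}
    (hy : Summable fun j => w j * y j ^ 2) (F : Finset ι) :
    ∑ j ∈ F, w j * (y j ^ 2 / v - 1) ≤ quadStat w v y + (∑' j, w j - ∑ j ∈ F, w j) := by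
  have hle := hy.sum_le_tsum F fun j _ => mul_nonneg (hw0 j) (sq_nonneg (y j))
  calc ∑ j ∈ F, w j * (y j ^ 2 / v - 1) = (v : ℝ)⁻¹ * ∑ j ∈ F, w j * y j ^ 2 - ∑ j ∈ F, w j := by
        rw [Finset.mul_sum, ← Finset.sum_sub_distrib]
        exact Finset.sum_congr rfl fun j _ => by ring
    _ ≤ (v : ℝ)⁻¹ * ∑' j, w j * y j ^ 2 - ∑ j ∈ F, w j := by gcongr
    _ = _ := by rw [quadStat]; ring

theorem measurable_quadStat [Countable ι] : Measurable (quadStat w v) :=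
  ((Measurable.tsum fun j => by fun_prop).const_mul _).sub_const _

theorem iIndepFun_mul_sq_gaussianSeq :
    iIndepFun (fun j y => w j * (y j ^ 2 / v - 1)) (gaussianSeq m v) :=
  iIndepFun_infinitePi (X := fun j x => w j * (x ^ 2 / v - 1)) fun j => by fun_prop

theorem mgf_mul_sq_gaussianSeq (j : ι) :
    mgf (fun y => w j * (y j ^ 2 / v - 1)) (gaussianSeq m v) t =
      mgf (fun x => x ^ 2 / v - 1) (gaussianReal (m j) v) (w j * t) := by
  rw [mgf_const_mul, ← (measurePreserving_eval_gaussianSeq j).map_eq,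
    mgf_map (measurePreserving_eval_gaussianSeq j).aemeasurable (by fun_prop)]
  rfl

theorem integrable_exp_sum_sq_gaussianSeq (hv : v ≠ 0) (ht : ∀ j, 2 * (w j * t) < 1)
    (F : Finset ι) :
    Integrable (fun y => Real.exp (t * ∑ j ∈ F, w j * (y j ^ 2 / v - 1))) (gaussianSeq m v) := by
  have h := iIndepFun_mul_sq_gaussianSeq (w := w) (m := m) (v := v).integrable_exp_mul_sum
    (t := t) (s := F) (fun j => by fun_prop) fun j _ => mgf_pos_iff.1 <| by
      rw [mgf_mul_sq_gaussianSeq, mgf_pos_iff]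
      exact integrable_exp_sq_gaussianReal _ hv (ht j)
  simpa only [Finset.sum_apply] using h

theorem mgf_sum_sq_gaussianSeq (F : Finset ι) :
    mgf (fun y => ∑ j ∈ F, w j * (y j ^ 2 / v - 1)) (gaussianSeq m v) t =
      ∏ j ∈ F, mgf (fun x => x ^ 2 / v - 1) (gaussianReal (m j) v) (w j * t) := by
  rw [← Finset.sum_fn, iIndepFun_mul_sq_gaussianSeq.mgf_sum (fun j => by fun_prop)]
  simp only [mgf_mul_sq_gaussianSeq]

theorem mgf_sum_sq_gaussianSeq_le (hv : v ≠ 0) (hw0 : ∀ j, 0 ≤ w j) (ht : ∀ j, |t| * w j ≤ 1 / 8)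
    (F : Finset ι) :
    mgf (fun y => ∑ j ∈ F, w j * (y j ^ 2 / v - 1)) (gaussianSeq m v) t ≤
      Real.exp (∑ j ∈ F,
        (3 * t ^ 2 * w j ^ 2 + (t + |t| / 2) * ((v : ℝ)⁻¹ * (w j * m j ^ 2)))) := by
  rw [mgf_sum_sq_gaussianSeq, Real.exp_sum]
  refine Finset.prod_le_prod (fun j _ => mgf_nonneg) fun j _ => ?_
  have habs : |w j * t| = |t| * w j := by rw [abs_mul, abs_of_nonneg (hw0 j), mul_comm]
  refine (mgf_sq_gaussianReal_le (m j) hv (habs.trans_le (ht j))).trans_eq ?_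
  rw [habs]
  ring_nf

theorem integrable_and_mgf_quadStat_le [Countable ι] (hv : v ≠ 0) (hw : Summable w)
    (hw0 : ∀ j, 0 ≤ w j) (hm : Summable fun j => w j * m j ^ 2) (ht : ∀ j, |t| * w j ≤ 1 / 8) :
    Integrable (fun y => Real.exp (t * quadStat w v y)) (gaussianSeq m v) ∧
      mgf (quadStat w v) (gaussianSeq m v) t ≤
        Real.exp (3 * t ^ 2 * ∑' j, w j ^ 2 + (t + |t| / 2) * meanShift w m v) := by
  have ht' (j : ι) : 2 * (w j * t) < 1 := by
    nlinarith [ht j, mul_le_mul_of_nonneg_left (le_abs_self t) (hw0 j)]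
  refine integrable_and_integral_le_of_tendsto (l := atTop)
    (integrable_exp_sum_sq_gaussianSeq hv ht') (fun F y => (Real.exp_pos _).le) ?_
    (mgf_sum_sq_gaussianSeq_le hv hw0 ht) ?_
  · filter_upwards [ae_summable_mul_sq hw hw0 hm] with y hy
    exact ((hasSum_quadStat hw hy).const_mul t).rexp
  · exact Filter.Tendsto.rexp (((summable_sq_of_nonneg hw hw0).hasSum.mul_left _).add
      ((hm.hasSum.mul_left _).mul_left _))

theorem exp_le_mgf_quadStat [Countable ι] (hv : v ≠ 0) (hw : Summable w) (hw0 : ∀ j, 0 ≤ w j)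
    (ht : 0 ≤ t) (htw : ∀ j, t * w j ≤ 1 / 8) :
    Real.exp (t ^ 2 * ∑' j, w j ^ 2) ≤ mgf (quadStat w v) (gaussianSeq 0 v) t := by
  have hm : Summable fun j => w j * (0 : ι → ℝ) j ^ 2 := by simp
  have hint := (integrable_and_mgf_quadStat_le hv hw hw0 hm
    (t := t) (by simpa only [abs_of_nonneg ht] using htw)).1
  have hfin (F : Finset ι) : Real.exp (∑ j ∈ F, t ^ 2 * w j ^ 2) ≤
      mgf (quadStat w v) (gaussianSeq 0 v) t * Real.exp (t * (∑' j, w j - ∑ j ∈ F, w j)) := by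
    rw [← mgf_add_const]
    calc Real.exp (∑ j ∈ F, t ^ 2 * w j ^ 2)
        ≤ mgf (fun y => ∑ j ∈ F, w j * (y j ^ 2 / v - 1)) (gaussianSeq 0 v) t := by
          rw [mgf_sum_sq_gaussianSeq, Real.exp_sum]
          refine Finset.prod_le_prod (fun j _ => (Real.exp_pos _).le) fun j _ => ?_
          rw [← mul_pow, mul_comm t]
          exact exp_sq_le_mgf_sq_gaussianReal hv (mul_nonneg (hw0 j) ht) (by linarith [htw j])
      _ ≤ _ := by
          refine mgf_mono_of_nonneg ?_ ht ?_
          · filter_upwards [ae_summable_mul_sq hw hw0 hm] with y hy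
            exact sum_mul_sub_one_le_quadStat_add hw0 hy F
          · simpa only [mul_add, Real.exp_add] using hint.mul_const _
  have hlim : Tendsto (fun F : Finset ι => mgf (quadStat w v) (gaussianSeq 0 v) t *
      Real.exp (t * (∑' j, w j - ∑ j ∈ F, w j))) atTop
      (𝓝 (mgf (quadStat w v) (gaussianSeq 0 v) t)) := by
    have h : Tendsto (fun F => t * (∑' j, w j - ∑ j ∈ F, w j)) atTop _ :=
      (Tendsto.const_sub _ hw.hasSum).const_mul t
    simpa only [sub_self, mul_zero, Real.exp_zero, mul_one] using
      h.rexp.const_mul (mgf (quadStat w v) (gaussianSeq 0 v) t)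
  exact le_of_tendsto_of_tendsto'
    (Filter.Tendsto.rexp ((summable_sq_of_nonneg hw hw0).hasSum.mul_left _)) hlim hfin

theorem measureReal_lt_quadStat_le [Countable ι] {x : ℝ} (hv : v ≠ 0) (hw : Summable w)
    (hw0 : ∀ j, 0 ≤ w j) (hm : Summable fun j => w j * m j ^ 2) (ht : 0 ≤ t)
    (htw : ∀ j, t * w j ≤ 1 / 8) :
    (gaussianSeq m v).real {y | x < quadStat w v y} ≤
      Real.exp (3 * t ^ 2 * ∑' j, w j ^ 2 + 3 / 2 * t * meanShift w m v - t * x) := by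
  obtain ⟨hint, hmgf⟩ := integrable_and_mgf_quadStat_le hv hw hw0 hm (t := t)
    (by simpa only [abs_of_nonneg ht] using htw)
  calc (gaussianSeq m v).real {y | x < quadStat w v y}
      ≤ (gaussianSeq m v).real {y | x ≤ quadStat w v y} :=
        measureReal_mono fun y (hy : x < quadStat w v y) => hy.le
    _ ≤ Real.exp (-t * x) * mgf (quadStat w v) (gaussianSeq m v) t :=
        measure_ge_le_exp_mul_mgf x ht hint
    _ ≤ _ := by
        grw [hmgf, ← Real.exp_add, abs_of_nonneg ht]
        exact (congrArg Real.exp (by ring)).le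

theorem measureReal_quadStat_le_le [Countable ι] {x : ℝ} (hv : v ≠ 0) (hw : Summable w)
    (hw0 : ∀ j, 0 ≤ w j) (hm : Summable fun j => w j * m j ^ 2) (ht : 0 ≤ t)
    (htw : ∀ j, t * w j ≤ 1 / 8) :
    (gaussianSeq m v).real {y | quadStat w v y ≤ x} ≤
      Real.exp (3 * t ^ 2 * ∑' j, w j ^ 2 - t / 2 * meanShift w m v + t * x) := by
  have habs : |-t| = t := by rw [abs_neg, abs_of_nonneg ht]
  obtain ⟨hint, hmgf⟩ := integrable_and_mgf_quadStat_le hv hw hw0 hm (t := -t)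
    (by simpa only [habs] using htw)
  grw [measure_le_le_exp_mul_mgf x (neg_nonpos.2 ht) hint, hmgf, ← Real.exp_add, habs]
  exact (congrArg Real.exp (by ring)).le

theorem exp_le_measureReal_lt_quadStat [Countable ι] {x : ℝ} (hv : v ≠ 0) (hw : Summable w)
    (hw0 : ∀ j, 0 ≤ w j) (ht : 0 < t) (htw : ∀ j, 2 * t * w j ≤ 1 / 8)
    (hx : t * x + 1 ≤ t ^ 2 * ∑' j, w j ^ 2) :
    Real.exp (-(10 * (t ^ 2 * ∑' j, w j ^ 2))) / 4 ≤
      (gaussianSeq 0 v).real {y | x < quadStat w v y} := by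
  set W := ∑' j, w j ^ 2
  set P := (gaussianSeq 0 v).real {y | x < quadStat w v y}
  have hm : Summable fun j => w j * (0 : ι → ℝ) j ^ 2 := by simp
  have htw' (j : ι) : t * w j ≤ 1 / 8 := by linarith [htw j, mul_nonneg ht.le (hw0 j)]
  have hlower : Real.exp (t ^ 2 * W) ≤ mgf (quadStat w v) (gaussianSeq 0 v) t :=
    exp_le_mgf_quadStat hv hw hw0 ht.le htw'
  obtain ⟨hint, -⟩ := integrable_and_mgf_quadStat_le hv hw hw0 hm (t := t)
    (by simpa only [abs_of_pos ht] using htw')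
  obtain ⟨hint_two, hupper⟩ := integrable_and_mgf_quadStat_le hv hw hw0 hm (t := 2 * t)
    (by simpa only [abs_of_pos (mul_pos two_pos ht)] using htw)
  have hexp_x : 2 * Real.exp (t * x) ≤ mgf (quadStat w v) (gaussianSeq 0 v) t :=
    calc 2 * Real.exp (t * x) ≤ Real.exp 1 * Real.exp (t * x) := by
          gcongr; linarith [Real.add_one_le_exp 1]
      _ ≤ Real.exp (t ^ 2 * W) := by rw [← Real.exp_add, add_comm]; gcongr
      _ ≤ _ := hlower
  have hP : Real.exp (2 * (t ^ 2 * W)) ≤ 4 * (Real.exp (12 * (t ^ 2 * W)) * P) :=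
    calc Real.exp (2 * (t ^ 2 * W)) = Real.exp (t ^ 2 * W) ^ 2 := by
          rw [← Real.exp_nat_mul, Nat.cast_two]
      _ ≤ mgf (quadStat w v) (gaussianSeq 0 v) t ^ 2 := by gcongr
      _ ≤ 4 * (mgf (quadStat w v) (gaussianSeq 0 v) (2 * t) * P) :=
          sq_mgf_le_mul_measureReal ht hint hint_two hexp_x
      _ ≤ 4 * (Real.exp (12 * (t ^ 2 * W)) * P) := by
          have hshift : meanShift w 0 v = 0 := by simp [meanShift]
          grw [hupper, hshift, mul_zero, add_zero]
          exact (congrArg (fun a => 4 * (Real.exp a * P)) (by ring)).le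
  have hsplit : Real.exp (-(10 * (t ^ 2 * W))) * Real.exp (12 * (t ^ 2 * W)) =
      Real.exp (2 * (t ^ 2 * W)) := by rw [← Real.exp_add]; ring_nf
  have hpos := Real.exp_pos (12 * (t ^ 2 * W))
  nlinarith

theorem measureReal_lt_quadStat_pos [Countable ι] (hv : v ≠ 0) (hw : Summable w)
    (hw0 : ∀ j, 0 ≤ w j) {i : ι} (hi : 0 < w i) (x : ℝ) :
    0 < (gaussianSeq 0 v).real {y | x < quadStat w v y} := by
  obtain ⟨C, hC⟩ : ∃ C, C = x + ∑' j, w j := ⟨_, rfl⟩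
  set U : Set ℝ := {s | C < w i * (s ^ 2 / v)}
  have hU : IsOpen U := isOpen_lt continuous_const (by fun_prop)
  have hUne : U.Nonempty := by
    have hlim : Tendsto (fun s : ℝ => w i * (s ^ 2 / v)) atTop atTop :=
      ((tendsto_pow_atTop two_ne_zero).atTop_div_const (by positivity)).const_mul_atTop hi
    exact (hlim.eventually_gt_atTop C).exists
  have hUpos : gaussianSeq 0 v (Function.eval i ⁻¹' U) ≠ 0 := by
    rw [(measurePreserving_eval_gaussianSeq i).measure_preimage
      hU.measurableSet.nullMeasurableSet]
    exact fun h => (hU.measure_pos volume hUne).ne' (gaussianReal_absolutelyContinuous' 0 hv h)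
  rw [measureReal_def, ENNReal.toReal_pos_iff]
  refine ⟨pos_iff_ne_zero.2 fun h => hUpos (measure_mono_null_ae ?_ h), measure_lt_top _ _⟩
  filter_upwards [ae_summable_mul_sq hw hw0 (by simp)] with y hy hyU
  have hsingle := sum_mul_sub_one_le_quadStat_add hw0 hy (v := v) {i}
  simp only [Finset.sum_singleton] at hsingle
  have : C < w i * (y i ^ 2 / v) := hyU
  change x < quadStat w v y
  linarith

end QuadStat

/-! ### Error probabilities at a fixed noise level -/

/-- The root `(∑ κ_{εj}⁴)^{1/2}`, which up to a constant factor is the standard deviation of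
the statistic `stat κ ε` in the absence of a signal. -/
noncomputable def noiseScale (κ : ℝ → ℕ → ℝ) (ε : ℝ) : ℝ := √(∑' j : ℕ+, κ ε j ^ 4)

/-- The signal-to-noise ratio: the mean of the statistic `stat κ ε` at the signal `S`, in units
of `noiseScale κ ε`. -/
noncomputable def snr (φ : ℕ+ → Signal) (κ : ℝ → ℕ → ℝ) (ε : ℝ) (S : Signal) : ℝ :=
  meanShift (fun j : ℕ+ => κ ε j ^ 2) (coeff φ S) (ε ^ 2).toNNReal / noiseScale κ ε

section ErrorProbabilities

variable {φ : ℕ+ → Signal} {κ : ℝ → ℕ → ℝ} {ε u z : ℝ} {S : Signal}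

instance : IsProbabilityMeasure (obsLaw φ ε S) :=
  inferInstanceAs (IsProbabilityMeasure (gaussianSeq _ _))

theorem coeff_zero : coeff φ 0 = 0 :=
  funext fun _ => inner_zero_right _

theorem coeff_smul (a : ℝ) (S : Signal) (j : ℕ+) : coeff φ (a • S) j = a * coeff φ S j :=
  real_inner_smul_right _ _ _

theorem snr_nonneg : 0 ≤ snr φ κ ε S :=
  div_nonneg (mul_nonneg (by positivity) (tsum_nonneg fun _ => by positivity))
    (Real.sqrt_nonneg _)

theorem snr_zero : snr φ κ ε 0 = 0 := by
  simp [snr, meanShift, coeff_zero]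

theorem snr_smul (a : ℝ) (S : Signal) : snr φ κ ε (a • S) = a ^ 2 * snr φ κ ε S := by
  simp only [snr, meanShift, coeff_smul, mul_pow, mul_left_comm _ (a ^ 2), tsum_mul_left]
  ring

theorem summable_mul_coeff_sq (hφ : ∀ j, ‖φ j‖ ≤ 1) (hκ : Summable fun j : ℕ+ => κ ε j ^ 2)
    (S : Signal) : Summable fun j : ℕ+ => κ ε j ^ 2 * coeff φ S j ^ 2 := by
  have hcoeff (j : ℕ+) : |coeff φ S j| ≤ ‖S‖ :=
    (abs_real_inner_le_norm _ _).trans (mul_le_of_le_one_left (norm_nonneg S) (hφ j))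
  refine (hκ.mul_right (‖S‖ ^ 2)).of_nonneg_of_le (fun j => by positivity) fun j => ?_
  gcongr ?_ * ?_
  exact sq_le_sq.2 ((hcoeff j).trans (le_abs_self _))

theorem tsum_sq_sq_eq_noiseScale_sq : ∑' j : ℕ+, (κ ε j ^ 2) ^ 2 = noiseScale κ ε ^ 2 := by
  rw [noiseScale, Real.sq_sqrt (tsum_nonneg fun j => by positivity)]
  simp only [← pow_mul]

theorem rejection_sq_mul (hε : 0 < ε) (hσ : 0 < noiseScale κ ε) (z : ℝ) :
    rejection κ ε (ε ^ 2 * z) =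
      {y | noiseScale κ ε * z < quadStat (fun j : ℕ+ => κ ε j ^ 2) (ε ^ 2).toNNReal y} := by
  have hA : √(Anorm κ ε) = noiseScale κ ε / ε ^ 2 := by
    rw [Anorm, ← div_eq_inv_mul, Real.sqrt_div' _ (by positivity), noiseScale,
      show ε ^ 4 = (ε ^ 2) ^ 2 by ring, Real.sqrt_sq (by positivity)]
  ext y
  simp only [rejection, Set.mem_ofPred_eq, hA, stat, rhoSq, quadStat,
    Real.coe_toNNReal _ (sq_nonneg ε)]
  rw [inv_mul_eq_div, lt_div_iff₀ (by positivity)]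
  field_simp

theorem typeII_eq_one_sub (hε : 0 < ε) (hσ : 0 < noiseScale κ ε) (z : ℝ) :
    typeII φ κ ε (ε ^ 2 * z) S = 1 - (obsLaw φ ε S).real (rejection κ ε (ε ^ 2 * z)) := by
  rw [typeII, rejection_sq_mul hε hσ]
  exact probReal_compl_eq_one_sub
    (measurableSet_lt measurable_const measurable_quadStat)

theorem typeI_pos (hε : 0 < ε) (hκ : Summable fun j : ℕ+ => κ ε j ^ 2)
    (hσ : 0 < noiseScale κ ε) (x : ℝ) : 0 < typeI φ κ ε x := by
  obtain ⟨i, hi⟩ : ∃ i : ℕ+, κ ε i ≠ 0 := by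
    by_contra! hzero
    simp [noiseScale, hzero] at hσ
  obtain ⟨z, rfl⟩ : ∃ z, x = ε ^ 2 * z := ⟨x / ε ^ 2, by field_simp⟩
  rw [typeI, rejection_sq_mul hε hσ, obsLaw, coeff_zero]
  exact measureReal_lt_quadStat_pos (by simpa using hε.ne') hκ (fun j => sq_nonneg _)
    (i := i) (by positivity) _

theorem measureReal_rejection_le (hε : 0 < ε) (hκ : Summable fun j : ℕ+ => κ ε j ^ 2)
    (hσ : 0 < noiseScale κ ε) (hφ : ∀ j, ‖φ j‖ ≤ 1) (hu : 0 ≤ u)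
    (hsmall : ∀ j : ℕ+, 8 * u * κ ε j ^ 2 ≤ noiseScale κ ε) :
    (obsLaw φ ε S).real (rejection κ ε (ε ^ 2 * z)) ≤
      Real.exp (3 * u ^ 2 + 3 / 2 * u * snr φ κ ε S - u * z) := by
  rw [rejection_sq_mul hε hσ]
  refine (measureReal_lt_quadStat_le (t := u / noiseScale κ ε) (by simpa using hε.ne') hκ
    (fun j => sq_nonneg _) (summable_mul_coeff_sq hφ hκ S) (by positivity) fun j => ?_).trans_eq ?_
  · rw [div_mul_eq_mul_div, div_le_iff₀ hσ]
    linarith [hsmall j]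
  · rw [tsum_sq_sq_eq_noiseScale_sq, snr]
    field_simp

theorem typeI_le (hε : 0 < ε) (hκ : Summable fun j : ℕ+ => κ ε j ^ 2)
    (hσ : 0 < noiseScale κ ε) (hφ : ∀ j, ‖φ j‖ ≤ 1) (hu : 0 ≤ u)
    (hsmall : ∀ j : ℕ+, 8 * u * κ ε j ^ 2 ≤ noiseScale κ ε) :
    typeI φ κ ε (ε ^ 2 * z) ≤ Real.exp (3 * u ^ 2 - u * z) := by
  simpa only [typeI, snr_zero, mul_zero, add_zero] using
    measureReal_rejection_le (S := 0) hε hκ hσ hφ hu hsmall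

theorem typeII_le (hε : 0 < ε) (hκ : Summable fun j : ℕ+ => κ ε j ^ 2)
    (hσ : 0 < noiseScale κ ε) (hφ : ∀ j, ‖φ j‖ ≤ 1) (hu : 0 ≤ u)
    (hsmall : ∀ j : ℕ+, 8 * u * κ ε j ^ 2 ≤ noiseScale κ ε) :
    typeII φ κ ε (ε ^ 2 * z) S ≤ Real.exp (3 * u ^ 2 - u / 2 * snr φ κ ε S + u * z) := by
  rw [typeII, rejection_sq_mul hε hσ]
  simp only [Set.compl_ofPred, not_lt]
  refine (measureReal_quadStat_le_le (t := u / noiseScale κ ε) (by simpa using hε.ne') hκ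
    (fun j => sq_nonneg _) (summable_mul_coeff_sq hφ hκ S) (by positivity) fun j => ?_).trans_eq ?_
  · rw [div_mul_eq_mul_div, div_le_iff₀ hσ]
    linarith [hsmall j]
  · rw [tsum_sq_sq_eq_noiseScale_sq, snr]
    field_simp

theorem exp_le_typeI (hε : 0 < ε) (hκ : Summable fun j : ℕ+ => κ ε j ^ 2)
    (hσ : 0 < noiseScale κ ε) (hz : 0 ≤ z)
    (hsmall : ∀ j : ℕ+, 16 * (z + 1) * κ ε j ^ 2 ≤ noiseScale κ ε) :
    Real.exp (-(10 * (z + 1) ^ 2)) / 4 ≤ typeI φ κ ε (ε ^ 2 * z) := by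
  have hcancel : ((z + 1) / noiseScale κ ε) ^ 2 * ∑' j : ℕ+, (κ ε j ^ 2) ^ 2 = (z + 1) ^ 2 := by
    rw [tsum_sq_sq_eq_noiseScale_sq]
    field_simp
  rw [typeI, rejection_sq_mul hε hσ, obsLaw, coeff_zero, ← hcancel]
  refine exp_le_measureReal_lt_quadStat (t := (z + 1) / noiseScale κ ε) (by simpa using hε.ne')
    hκ (fun j => sq_nonneg _) (by positivity) (fun j => ?_) ?_
  · rw [← mul_div_assoc, div_mul_eq_mul_div, div_le_iff₀ hσ]
    linarith [hsmall j]
  · rw [hcancel, div_mul_eq_mul_div, mul_left_comm, mul_div_cancel_left₀ _ hσ.ne']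
    nlinarith

theorem typeII_le_exp_of_lt_log_typeI {x : ℝ} (hε : 0 < ε)
    (hκ : Summable fun j : ℕ+ => κ ε j ^ 2) (hσ : 0 < noiseScale κ ε) (hφ : ∀ j, ‖φ j‖ ≤ 1)
    (hu : 0 < u) (hsmall : ∀ j : ℕ+, 8 * u * κ ε j ^ 2 ≤ noiseScale κ ε)
    (hlog : -u ^ 2 < Real.log (typeI φ κ ε x)) (hsnr : 16 * u ≤ snr φ κ ε S) :
    typeII φ κ ε x S ≤ Real.exp (-u ^ 2) := by
  obtain ⟨z, rfl⟩ : ∃ z, x = ε ^ 2 * z := ⟨x / ε ^ 2, by field_simp⟩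
  have hz : z < 4 * u := by
    have hbound : Real.log (typeI φ κ ε (ε ^ 2 * z)) ≤ 3 * u ^ 2 - u * z :=
      (Real.log_le_iff_le_exp (typeI_pos hε hκ hσ _)).2 (typeI_le hε hκ hσ hφ hu.le hsmall)
    nlinarith
  refine (typeII_le hε hκ hσ hφ hu.le hsmall).trans (Real.exp_le_exp.2 ?_)
  nlinarith [mul_le_mul_of_nonneg_left hz.le hu.le, mul_le_mul_of_nonneg_left hsnr hu.le]

theorem half_le_typeII (hε : 0 < ε) (hκ : Summable fun j : ℕ+ => κ ε j ^ 2)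
    (hσ : 0 < noiseScale κ ε) (hφ : ∀ j, ‖φ j‖ ≤ 1)
    (hsmall : ∀ j : ℕ+, 8 * κ ε j ^ 2 ≤ noiseScale κ ε) (hz : 2 * snr φ κ ε S + 4 ≤ z) :
    1 / 2 ≤ typeII φ κ ε (ε ^ 2 * z) S := by
  have hreject := measureReal_rejection_le (S := S) (z := z) hε hκ hσ hφ zero_le_one
    (by simpa only [mul_one] using hsmall)
  have hexp : Real.exp (3 * 1 ^ 2 + 3 / 2 * 1 * snr φ κ ε S - 1 * z) ≤ Real.exp (-1) :=
    Real.exp_le_exp.2 (by linarith [snr_nonneg (φ := φ) (κ := κ) (ε := ε) (S := S)])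
  rw [typeII_eq_one_sub hε hσ]
  linarith [Real.exp_neg_one_lt_half]

end ErrorProbabilities

/-! ### Large deviation consistency in terms of the signal-to-noise ratio -/

theorem exists_strictMono_of_not_isLittleO {E F : Type*} [Norm E] [SeminormedAddCommGroup F]
    {f : ℕ → E} {g : ℕ → F} (hfg : ¬ f =o[atTop] g) :
    ∃ c > 0, ∃ n : ℕ → ℕ, StrictMono n ∧ ∀ i, c * ‖g (n i)‖ < ‖f (n i)‖ := by
  rw [isLittleO_iff] at hfg
  push Not at hfg
  obtain ⟨c, hc, hfreq⟩ := hfg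
  exact ⟨c, hc, extraction_of_frequently_atTop hfreq⟩

theorem exists_seq_isLittleO_of_not_isBigO {α E F : Type*} [SeminormedAddCommGroup E] [Norm F]
    {l : Filter α} [l.IsCountablyGenerated] {f : α → E} {g : α → F} (hgf : ¬ g =O[l] f)
    {s : Set α} (hs : s ∈ l) :
    ∃ x : ℕ → α, (∀ k, x k ∈ s) ∧ Tendsto x atTop l ∧ (f ∘ x) =o[atTop] (g ∘ x) := by
  obtain ⟨B, hB⟩ := l.exists_antitone_basis
  have hlarge (k : ℕ) : ∃ x ∈ B k, k * ‖f x‖ < ‖g x‖ ∧ x ∈ s := by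
    have hfreq : ∃ᶠ x in l, k * ‖f x‖ < ‖g x‖ := by
      rw [isBigO_iff] at hgf
      push Not at hgf
      exact hgf k
    obtain ⟨x, ⟨hlt, hxs⟩, hxB⟩ := ((hfreq.and_eventually hs).and_eventually (hB.mem k)).exists
    exact ⟨x, hxB, hlt, hxs⟩
  choose x hxB hlt hxs using hlarge
  refine ⟨x, hxs, hB.tendsto hxB, isLittleO_iff.2 fun c hc => ?_⟩
  filter_upwards [eventually_ge_atTop ⌈c⁻¹⌉₊] with k hk
  have hck : 1 ≤ c * k := (inv_le_iff_one_le_mul₀' hc).1 (Nat.ceil_le.1 hk)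
  calc ‖f (x k)‖ ≤ c * k * ‖f (x k)‖ := le_mul_of_one_le_left (norm_nonneg _) hck
    _ = c * (k * ‖f (x k)‖) := mul_assoc _ _ _
    _ ≤ c * ‖g (x k)‖ := by gcongr; exact (hlt k).le

/-- Weights for which large deviations at the scale `ε^{-2ω}` are governed by the Gaussian
approximation: no single weight dominates, being small compared to `ε^{2ω} (∑ κ_{εj}⁴)^{1/2}`
uniformly in `j`. -/
structure ModerateWeights (κ : ℝ → ℕ → ℝ) (ω : ℝ) : Prop where
  summable : ∀ ε : ℝ, 0 < ε → Summable fun j : ℕ+ => κ ε j ^ 2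
  noiseScale_pos : ∀ ε : ℝ, 0 < ε → 0 < noiseScale κ ε
  eventually_le : ∀ a : ℝ, ∀ᶠ ε in 𝓝[>] 0, ∀ j : ℕ+,
    a * ε ^ (-2 * ω) * κ ε j ^ 2 ≤ noiseScale κ ε

section Consistency

variable {φ : ℕ+ → Signal} {κ : ℝ → ℕ → ℝ} {ω : ℝ}

theorem ModerateWeights.ldConsistent {ι : Type} {l : Filter ι} {e : ι → ℝ} {S : ι → Signal}
    (h : ModerateWeights κ ω) (hφ : ∀ j, ‖φ j‖ ≤ 1) (he : Tendsto e l (𝓝[>] 0))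
    (hS : (fun i => e i ^ (-2 * ω)) =O[l] fun i => snr φ κ (e i) (S i)) :
    LDConsistent φ κ ω l e S := by
  intro x hx
  obtain ⟨C, hC, hbound⟩ := hS.exists_pos
  have ha : 0 < (16 * C)⁻¹ := by positivity
  refine ⟨((16 * C)⁻¹) ^ 2, by positivity, ?_⟩
  filter_upwards [he.eventually self_mem_nhdsWithin, hbound.bound,
    he.eventually (h.eventually_le (8 * (16 * C)⁻¹)),
    hx.eventually_const_lt (neg_lt_zero.2 (pow_pos ha 2))]
    with i (hei : 0 < e i) hsnr hsmall hlog
  have hR : 0 < e i ^ (-2 * ω) := Real.rpow_pos_of_pos hei _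
  rw [Real.norm_of_nonneg hR.le, Real.norm_of_nonneg snr_nonneg] at hsnr
  rw [← mul_pow]
  refine typeII_le_exp_of_lt_log_typeI hei (h.summable _ hei) (h.noiseScale_pos _ hei) hφ
    (by positivity) (fun j => by simpa only [mul_assoc] using hsmall j) ?_ ?_
  · rw [mul_pow, neg_mul_eq_neg_mul]
    rwa [inv_mul_eq_div, lt_div_iff₀ (by positivity)] at hlog
  · rw [← div_eq_inv_mul, ← mul_div_assoc, mul_div_mul_left _ _ (by norm_num), div_le_iff₀' hC]
    exact hsnr

theorem ModerateWeights.log_typeI_isBigO {ι : Type*} {l : Filter ι} {e z : ι → ℝ}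
    (h : ModerateWeights κ ω) (he : Tendsto e l (𝓝[>] 0)) (hz0 : ∀ᶠ i in l, 0 ≤ z i)
    (hz : (fun i => z i + 1) =O[l] fun i => e i ^ (-2 * ω)) :
    (fun i => Real.log (typeI φ κ (e i) (e i ^ 2 * z i))) =O[l] fun i => (z i + 1) ^ 2 := by
  obtain ⟨C, hC⟩ := hz.bound
  refine IsBigO.of_bound (10 + Real.log 4) ?_
  filter_upwards [he.eventually self_mem_nhdsWithin, hz0, hC,
    he.eventually (h.eventually_le (16 * C))] with i (hei : 0 < e i) hzi hCi hsmall
  have hσ := h.noiseScale_pos _ hei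
  have hα := typeI_pos (φ := φ) hei (h.summable _ hei) hσ (e i ^ 2 * z i)
  rw [Real.norm_of_nonneg (by positivity), Real.norm_of_nonneg (by positivity)] at hCi
  have hlower := Real.log_le_log (by positivity) <|
    exp_le_typeI (φ := φ) hei (h.summable _ hei) hσ hzi fun j =>
      (hsmall j).trans' (by rw [mul_assoc 16 C]; gcongr)
  rw [Real.log_div (Real.exp_ne_zero _) (by norm_num), Real.log_exp] at hlower
  rw [Real.norm_of_nonpos (Real.log_nonpos hα.le measureReal_le_one),
    Real.norm_of_nonneg (sq_nonneg _)]
  have hlog : Real.log 4 ≤ Real.log 4 * (z i + 1) ^ 2 :=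
    le_mul_of_one_le_right (Real.log_nonneg (by norm_num)) (one_le_pow₀ (by linarith))
  linarith

theorem ModerateWeights.not_ldConsistent {ι : Type} {l : Filter ι} [l.NeBot] {e : ι → ℝ}
    {S : ι → Signal} (h : ModerateWeights κ ω) (hω : 0 < ω) (hφ : ∀ j, ‖φ j‖ ≤ 1)
    (he : Tendsto e l (𝓝[>] 0))
    (hS : (fun i => snr φ κ (e i) (S i)) =o[l] fun i => e i ^ (-2 * ω)) :
    ¬ LDConsistent φ κ ω l e S := by
  intro hcons
  have hR : Tendsto (fun i => e i ^ (-2 * ω)) l atTop :=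
    (tendsto_rpow_neg_nhdsGT_zero (by linarith)).comp he
  set z : ι → ℝ := fun i => 2 * snr φ κ (e i) (S i) + 4
  have hz0 (i : ι) : 0 ≤ z i :=
    add_nonneg (mul_nonneg zero_le_two snr_nonneg) zero_le_four
  have hconst (a : ℝ) : (fun _ => a) =o[l] fun i => e i ^ (-2 * ω) :=
    isLittleO_const_left.2 (Or.inr (tendsto_norm_atTop_atTop.comp hR))
  have hz : (fun i => z i + 1) =o[l] fun i => e i ^ (-2 * ω) :=
    ((hS.const_mul_left 2).add (hconst 4)).add (hconst 1)
  have hα := (h.log_typeI_isBigO (φ := φ) he (.of_forall hz0) hz.isBigO).trans_isLittleO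
    (hz.pow two_pos)
  obtain ⟨c, hc, hβ⟩ := hcons (fun i => e i ^ 2 * z i) (by
    simpa only [div_eq_inv_mul] using hα.tendsto_div_nhds_zero)
  have hexp : Tendsto (fun i => Real.exp (-(c * (e i ^ (-2 * ω)) ^ 2))) l (𝓝 0) :=
    Real.tendsto_exp_neg_atTop_nhds_zero.comp
      (((tendsto_pow_atTop two_ne_zero).comp hR).const_mul_atTop hc)
  have hhalf : ∀ᶠ i in l, 1 / 2 ≤ typeII φ κ (e i) (e i ^ 2 * z i) (S i) := by
    filter_upwards [he.eventually self_mem_nhdsWithin, he.eventually (h.eventually_le 8),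
      hR.eventually_ge_atTop 1] with i (hei : 0 < e i) hsmall hRi
    exact half_le_typeII hei (h.summable _ hei) (h.noiseScale_pos _ hei) hφ
      (fun j => (hsmall j).trans' (by gcongr; linarith)) le_rfl
  obtain ⟨i, hhalf_i, hβ_i, hexp_i⟩ :=
    (hhalf.and (hβ.and (hexp.eventually_lt_const one_half_pos))).exists
  linarith

theorem ModerateWeights.ldInconsistent_iff_isLittleO {e : ℕ → ℝ} {S : ℕ → Signal}
    (h : ModerateWeights κ ω) (hω : 0 < ω) (hφ : ∀ j, ‖φ j‖ ≤ 1)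
    (he : Tendsto e atTop (𝓝[>] 0)) :
    LDInconsistent φ κ ω e S ↔
      (fun i => snr φ κ (e i) (S i)) =o[atTop] fun i => e i ^ (-2 * ω) := by
  refine ⟨fun hinc => ?_, fun hS n hn =>
    h.not_ldConsistent hω hφ (he.comp hn.tendsto_atTop) (hS.comp_tendsto hn.tendsto_atTop)⟩
  by_contra hnot
  obtain ⟨c, hc, n, hn, hlt⟩ := exists_strictMono_of_not_isLittleO hnot
  refine hinc n hn (h.ldConsistent hφ (he.comp hn.tendsto_atTop) (.of_bound c⁻¹ ?_))
  exact .of_forall fun i => (le_inv_mul_iff₀ hc).2 (hlt i).le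

theorem LDInconsistent.comp {e : ℕ → ℝ} {S : ℕ → Signal} (hS : LDInconsistent φ κ ω e S)
    {n : ℕ → ℕ} (hn : StrictMono n) : LDInconsistent φ κ ω (e ∘ n) (S ∘ n) :=
  fun m hm => hS (n ∘ m) (hn.comp hm)

theorem ModerateWeights.ldInconsistent_smul {e p : ℕ → ℝ} {S : ℕ → Signal}
    (h : ModerateWeights κ ω) (hω : 0 < ω) (hφ : ∀ j, ‖φ j‖ ≤ 1)
    (he : Tendsto e atTop (𝓝[>] 0)) (hp : p =O[atTop] fun _ => (1 : ℝ))
    (hS : LDInconsistent φ κ ω e S) : LDInconsistent φ κ ω e fun i => p i • S i := by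
  rw [h.ldInconsistent_iff_isLittleO hω hφ he] at hS ⊢
  simpa only [snr_smul, one_pow, one_mul] using (hp.pow 2).mul_isLittleO hS

theorem ModerateWeights.exists_ldInconsistent_of_not_ldConsistent {S : ℝ → Signal}
    (h : ModerateWeights κ ω) (hω : 0 < ω) (hφ : ∀ j, ‖φ j‖ ≤ 1)
    (hS : ¬ LDConsistent φ κ ω (𝓝[>] 0) id S) :
    ∃ e : ℕ → ℝ, (∀ i, 0 < e i) ∧ Tendsto e atTop (𝓝[>] 0) ∧
      LDInconsistent φ κ ω e (S ∘ e) := by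
  obtain ⟨e, he0, he, hsnr⟩ := exists_seq_isLittleO_of_not_isBigO
    (fun hbig => hS (h.ldConsistent hφ tendsto_id hbig)) self_mem_nhdsWithin
  exact ⟨e, he0, he, (h.ldInconsistent_iff_isLittleO hω hφ he).2 hsnr⟩

end Consistency

section Weights

variable {κ : ℝ → ℕ → ℝ} {r ω ε : ℝ}

theorem kIndex_mul_kappaSq_sq_le (hε : 0 < ε) (hκ : Summable fun j : ℕ+ => κ ε j ^ 2)
    (hA1 : CondA1 κ) : (kIndex κ ε : ℝ) * kappaSq κ ε ^ 2 ≤ noiseScale κ ε ^ 2 := by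
  rcases (kIndex κ ε).eq_zero_or_pos with hzero | hpos
  · rw [hzero, Nat.cast_zero, zero_mul]
    positivity
  obtain ⟨k, hk⟩ : ∃ k : ℕ+, (k : ℕ) = kIndex κ ε := ⟨⟨_, hpos⟩, rfl⟩
  have hle : ∀ j ∈ Finset.Icc 1 k, kappaSq κ ε ^ 2 ≤ (κ ε j ^ 2) ^ 2 := fun j hj =>
    pow_le_pow_left₀ (sq_nonneg _)
      (hA1 ε hε j _ j.pos (((PNat.coe_le_coe j k).2 (Finset.mem_Icc.1 hj).2).trans_eq hk)) 2
  have hcard : (Finset.Icc 1 k).card = kIndex κ ε := by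
    rw [PNat.card_Icc, PNat.one_coe, Nat.add_sub_cancel, hk]
  calc (kIndex κ ε : ℝ) * kappaSq κ ε ^ 2
      ≤ ∑ j ∈ Finset.Icc 1 k, (κ ε j ^ 2) ^ 2 := by
        simpa only [hcard, nsmul_eq_mul] using Finset.card_nsmul_le_sum _ _ _ hle
    _ ≤ ∑' j : ℕ+, (κ ε j ^ 2) ^ 2 :=
        (summable_sq_of_nonneg hκ fun j => sq_nonneg _).sum_le_tsum _ fun j _ => sq_nonneg _
    _ = noiseScale κ ε ^ 2 := tsum_sq_sq_eq_noiseScale_sq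

theorem rpow_mul_first_isLittleO_noiseScale (hω : 2 * ω < 1 - 2 * r)
    (hκ : ∀ ε : ℝ, 0 < ε → Summable fun j : ℕ+ => κ ε j ^ 2) (hA1 : CondA1 κ)
    (hfirst : (fun ε : ℝ => κ ε 1 ^ 2) =O[𝓝[>] 0] fun ε : ℝ => kappaSq κ ε)
    (hk : (fun ε : ℝ => ε ^ (-4 + 8 * r + 4 * ω)) =O[𝓝[>] 0]
      fun ε : ℝ => (kIndex κ ε : ℝ)) :
    (fun ε : ℝ => ε ^ (-2 * ω) * κ ε 1 ^ 2) =o[𝓝[>] 0] fun ε => noiseScale κ ε := by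
  have hσ : (fun ε : ℝ => (kIndex κ ε : ℝ) * kappaSq κ ε ^ 2) =O[𝓝[>] 0]
      fun ε => noiseScale κ ε ^ 2 := by
    refine .of_norm_eventuallyLE ?_
    filter_upwards [self_mem_nhdsWithin] with ε (hε : 0 < ε)
    rw [Real.norm_of_nonneg (by positivity)]
    exact kIndex_mul_kappaSq_sq_le hε (hκ ε hε) hA1
  have hvanish : (fun ε : ℝ => ε ^ (4 - 8 * r - 8 * ω)) =o[𝓝[>] 0] fun _ => (1 : ℝ) := by
    have hexp : 0 < 4 - 8 * r - 8 * ω := by linarith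
    refine (isLittleO_one_iff ℝ).2 ?_
    simpa only [Real.zero_rpow hexp.ne'] using
      ((Real.continuousAt_rpow_const 0 _ (.inr hexp.le)).tendsto.mono_left nhdsWithin_le_nhds)
  refine IsLittleO.of_pow (n := 2) ?_ two_ne_zero
  refine (hvanish.mul_isBigO ((hk.mul (hfirst.pow 2)).trans hσ)).congr' ?_ (.of_eq ?_)
  · filter_upwards [self_mem_nhdsWithin] with ε (hε : 0 < ε)
    rw [← mul_assoc, ← Real.rpow_add hε, Pi.pow_apply, mul_pow, ← Real.rpow_mul_natCast hε.le]
    congr 2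
    push_cast
    ring
  · funext ε
    simp only [one_mul, Pi.pow_apply]

theorem moderateWeights (hω : 2 * ω < 1 - 2 * r)
    (hκ : ∀ ε : ℝ, 0 < ε → Summable fun j : ℕ+ => κ ε j ^ 2) (hA1 : CondA1 κ)
    (hA2 : CondA2 κ)
    (hfirst : (fun ε : ℝ => κ ε 1 ^ 2) =O[𝓝[>] 0] fun ε : ℝ => kappaSq κ ε)
    (hk : (fun ε : ℝ => ε ^ (-4 + 8 * r + 4 * ω)) =O[𝓝[>] 0]
      fun ε : ℝ => (kIndex κ ε : ℝ)) :
    ModerateWeights κ ω where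
  summable := hκ
  noiseScale_pos ε hε := by
    obtain ⟨C₁, C₂, hC₁, hA⟩ := hA2
    exact Real.sqrt_pos.2 (pos_of_mul_pos_right (hC₁.trans (hA ε hε).1) (by positivity))
  eventually_le a := by
    have hsmall := (rpow_mul_first_isLittleO_noiseScale hω hκ hA1 hfirst hk).const_mul_left |a|
    filter_upwards [self_mem_nhdsWithin, hsmall.bound one_pos] with ε (hε : 0 < ε) hle j
    rw [one_mul, Real.norm_of_nonneg (by positivity),
      Real.norm_of_nonneg (show 0 ≤ noiseScale κ ε from Real.sqrt_nonneg _), ← mul_assoc] at hle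
    refine le_trans ?_ hle
    gcongr ?_ * _ * ?_
    · exact le_abs_self a
    · exact hA1 ε hε 1 j le_rfl j.pos

end Weights

/-! ### Projections onto inconsistent sequences -/

section Projection

variable {ι E : Type*} [NormedAddCommGroup E] [InnerProductSpace ℝ E] {l : Filter ι}
  {f g : ι → E}

theorem isBigO_inner_div_norm_sq (hfg : f =O[l] g) :
    (fun i => inner ℝ (f i) (g i) / ‖g i‖ ^ 2) =O[l] fun _ => (1 : ℝ) := by
  obtain ⟨C, hC0, hC⟩ := hfg.exists_nonneg
  refine .of_bound C (hC.bound.mono fun i hi => ?_)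
  rw [norm_div, norm_pow, norm_norm, norm_one, mul_one]
  rcases eq_or_ne (g i) 0 with hg | hg
  · simpa [hg] using hC0
  refine (div_le_iff₀ (by positivity)).2 ?_
  calc ‖inner ℝ (f i) (g i)‖ ≤ ‖f i‖ * ‖g i‖ := norm_inner_le_norm _ _
    _ ≤ C * ‖g i‖ * ‖g i‖ := by gcongr
    _ = C * ‖g i‖ ^ 2 := by ring

theorem inner_div_norm_sq_smul (x y : E) :
    inner ℝ ((inner ℝ x y / ‖y‖ ^ 2) • y) y = inner ℝ x y := by
  rcases eq_or_ne y 0 with rfl | hy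
  · simp only [inner_zero_right]
  · rw [real_inner_smul_left, real_inner_self_eq_norm_sq, div_mul_cancel₀]
    simpa using hy

theorem inner_div_norm_sq_smul_sub (x y : E) :
    inner ℝ ((inner ℝ x y / ‖y‖ ^ 2) • y) (x - (inner ℝ x y / ‖y‖ ^ 2) • y) = 0 := by
  rw [inner_sub_right, real_inner_smul_right, inner_div_norm_sq_smul, real_inner_smul_left,
    real_inner_comm, sub_self]

theorem inner_eq_norm_sq_of_inner_sub_eq_zero {x y : E} (hxy : inner ℝ y (x - y) = 0) :
    inner ℝ x y = ‖y‖ ^ 2 := by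
  rwa [inner_sub_right, real_inner_self_eq_norm_sq, sub_eq_zero, real_inner_comm] at hxy

theorem norm_le_of_inner_sub_eq_zero {x y : E} (hxy : inner ℝ y (x - y) = 0) : ‖y‖ ≤ ‖x‖ := by
  have hpyth := norm_add_sq_eq_norm_sq_add_norm_sq_real hxy
  rw [add_sub_cancel] at hpyth
  exact (mul_self_le_mul_self_iff (norm_nonneg y) (norm_nonneg x)).2
    (hpyth.symm ▸ le_add_of_nonneg_right (mul_self_nonneg _))

end Projection

section PureConsistency

variable {φ : ℕ+ → Signal} {κ : ℝ → ℕ → ℝ} {r ω : ℝ} {S : ℝ → Signal}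

theorem ModerateWeights.purelyLDConsistent_iff (h : ModerateWeights κ ω) (hω : 0 < ω)
    (hφ : ∀ j, ‖φ j‖ ≤ 1) (hS : (fun ε : ℝ => ε ^ (2 * r)) =O[𝓝[>] 0] S) :
    PurelyLDConsistent φ κ r ω S ↔
      ∀ (e : ℕ → ℝ) (S₁ : ℕ → Signal), (∀ i, 0 < e i) → Tendsto e atTop (𝓝 0) →
        LDInconsistent φ κ ω e S₁ → (∀ i, inner ℝ (S₁ i) (S (e i) - S₁ i) = 0) →
        S₁ =o[atTop] fun i => e i ^ (2 * r) := by
  constructor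
  · rintro ⟨-, hpure⟩ e S₁ he0 he hinc horth
    by_contra hnot
    obtain ⟨c, hc, n, hn, hlt⟩ := exists_strictMono_of_not_isLittleO hnot
    refine hpure ⟨e ∘ n, S₁ ∘ n, c, fun i => he0 _, he.comp hn.tendsto_atTop, hinc.comp hn,
      fun i => horth _, hc, fun i => ?_⟩
    simpa only [Function.comp_apply, Real.norm_of_nonneg (Real.rpow_nonneg (he0 _).le _)]
      using hlt i
  · refine fun hsmall => ⟨?_, ?_⟩
    · by_contra hcons
      obtain ⟨e, he0, he, hinc⟩ := h.exists_ldInconsistent_of_not_ldConsistent hω hφ hcons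
      have hρ := (hS.comp_tendsto he).trans_isLittleO <|
        hsmall e (S ∘ e) he0 (he.mono_right nhdsWithin_le_nhds) hinc fun i => by simp
      exact isLittleO_irrefl (.of_forall fun i => (Real.rpow_pos_of_pos (he0 i) _).ne') hρ
    · rintro ⟨e, S₁, c, he0, he, hinc, horth, hc, hlt⟩
      obtain ⟨i, hi⟩ := ((hsmall e S₁ he0 he hinc horth).bound hc).exists
      rw [Real.norm_of_nonneg (Real.rpow_nonneg (he0 i).le _)] at hi
      exact (hlt i).not_ge hi

theorem ModerateWeights.inner_isLittleO {e : ℕ → ℝ} {S₁ : ℕ → Signal}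
    (h : ModerateWeights κ ω) (hω : 0 < ω) (hφ : ∀ j, ‖φ j‖ ≤ 1)
    (hS : S =O[𝓝[>] 0] fun ε : ℝ => ε ^ (2 * r))
    (horth : ∀ S₁ : ℕ → Signal, LDInconsistent φ κ ω e S₁ →
      (∀ i, inner ℝ (S₁ i) (S (e i) - S₁ i) = 0) → S₁ =o[atTop] fun i => e i ^ (2 * r))
    (he : Tendsto e atTop (𝓝[>] 0)) (hS₁ : S₁ =Θ[atTop] fun i => e i ^ (2 * r))
    (hinc : LDInconsistent φ κ ω e S₁) :
    (fun i => inner ℝ (S (e i)) (S₁ i)) =o[atTop] fun i => (e i ^ (2 * r)) ^ 2 := by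
  have hcoeff : (fun i => inner ℝ (S (e i)) (S₁ i) / ‖S₁ i‖ ^ 2) =O[atTop] fun _ => (1 : ℝ) :=
    isBigO_inner_div_norm_sq ((hS.comp_tendsto he).trans hS₁.isBigO_symm)
  have hproj := horth _ (h.ldInconsistent_smul hω hφ he hcoeff hinc) fun i =>
    inner_div_norm_sq_smul_sub _ _
  have hcs : (fun i => inner ℝ (S (e i)) (S₁ i)) =O[atTop] fun i =>
      ‖(inner ℝ (S (e i)) (S₁ i) / ‖S₁ i‖ ^ 2) • S₁ i‖ * ‖S₁ i‖ := by
    refine .of_norm_le fun i => ?_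
    conv_lhs => rw [← inner_div_norm_sq_smul]
    exact norm_inner_le_norm _ _
  simpa only [sq] using hcs.trans_isLittleO (hproj.norm_left.mul_isBigO hS₁.isBigO.norm_left)

theorem isLittleO_of_inner_isLittleO {e : ℕ → ℝ} {S₁ : ℕ → Signal} (he0 : ∀ i, 0 < e i)
    (he : Tendsto e atTop (𝓝[>] 0)) (hS : S =O[𝓝[>] 0] fun ε : ℝ => ε ^ (2 * r))
    (hinner : ∀ n : ℕ → ℕ, StrictMono n →
      ((S₁ ∘ n) =Θ[atTop] fun i => e (n i) ^ (2 * r)) →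
      (fun i => inner ℝ (S (e (n i))) (S₁ (n i))) =o[atTop] fun i => (e (n i) ^ (2 * r)) ^ 2)
    (horth : ∀ i, inner ℝ (S₁ i) (S (e i) - S₁ i) = 0) :
    S₁ =o[atTop] fun i => e i ^ (2 * r) := by
  by_contra hnot
  obtain ⟨c, hc, n, hn, hlt⟩ := exists_strictMono_of_not_isLittleO hnot
  have hupper : (S₁ ∘ n) =O[atTop] fun i => e (n i) ^ (2 * r) :=
    (isBigO_of_le _ fun i => norm_le_of_inner_sub_eq_zero (horth (n i))).trans
      (hS.comp_tendsto (he.comp hn.tendsto_atTop))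
  have hlower : (fun i => e (n i) ^ (2 * r)) =O[atTop] (S₁ ∘ n) :=
    .of_bound c⁻¹ (.of_forall fun i => (le_inv_mul_iff₀ hc).2 (hlt i).le)
  have hsq := hinner n hn ⟨hupper, hlower⟩
  simp only [inner_eq_norm_sq_of_inner_sub_eq_zero (horth _)] at hsq
  have hsmall : (S₁ ∘ n) =o[atTop] fun i => e (n i) ^ (2 * r) :=
    (IsLittleO.of_pow hsq two_ne_zero).of_norm_left
  exact isLittleO_irrefl (.of_forall fun i => (Real.rpow_pos_of_pos (he0 (n i)) _).ne')
    (hlower.trans_isLittleO hsmall)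

end PureConsistency

end SignalDetection

theorem mainTheorem6_general
    {r ω : ℝ} (hω : 0 < ω) {φ : ℕ+ → Signal} (hφ : ∀ j, ‖φ j‖ ≤ 1)
    {κ : ℝ → ℕ → ℝ} (hκ : ModerateWeights κ ω) {S : ℝ → Signal}
    (hS : (fun ε : ℝ => ‖S ε‖) =Θ[𝓝[>] 0] fun ε : ℝ => ε ^ (2 * r)) :
    PurelyLDConsistent φ κ r ω S ↔
      ∀ (e : ℕ → ℝ) (S₁ : ℕ → Signal), (∀ i, 0 < e i) → Tendsto e atTop (𝓝 0) →
        ((fun i => ‖S₁ i‖) =Θ[atTop] fun i => e i ^ (2 * r)) →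
        LDInconsistent φ κ ω e S₁ →
        (fun i => ‖S (e i) + S₁ i‖ ^ 2 - (‖S (e i)‖ ^ 2 + ‖S₁ i‖ ^ 2))
          =o[atTop] fun i => e i ^ (4 * r) := by
  have hcross (x y : Signal) : ‖x + y‖ ^ 2 - (‖x‖ ^ 2 + ‖y‖ ^ 2) = 2 * inner ℝ x y := by
    rw [norm_add_sq_real]
    ring
  have hsq {t : ℝ} (ht : 0 < t) : t ^ (4 * r) = (t ^ (2 * r)) ^ 2 := by
    rw [← Real.rpow_mul_natCast ht.le]
    congr 1
    push_cast
    ring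
  rw [isTheta_norm_left] at hS
  simp only [hκ.purelyLDConsistent_iff hω hφ hS.isBigO_symm, hcross,
    isLittleO_const_mul_left_iff (two_ne_zero' ℝ), isTheta_norm_left]
  constructor
  · intro horth e S₁ he0 he hS₁ hinc
    simp only [hsq (he0 _)]
    exact hκ.inner_isLittleO hω hφ hS.isBigO (fun S₂ => horth e S₂ he0 he)
      (tendsto_nhdsWithin_iff.2 ⟨he, .of_forall he0⟩) hS₁ hinc
  · intro hinner e S₁ he0 he hinc horth
    refine isLittleO_of_inner_isLittleO he0 (tendsto_nhdsWithin_iff.2 ⟨he, .of_forall he0⟩)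
      hS.isBigO (fun n hn hΘ => ?_) horth
    simpa only [Function.comp_apply, hsq (he0 _)] using
      hinner (e ∘ n) (S₁ ∘ n) (fun i => he0 _) (he.comp hn.tendsto_atTop) hΘ (hinc.comp hn)

theorem mainTheorem6
    (r ω : ℝ) (hr : 0 < r) (hr' : r < 1 / 2) (hω : 0 < ω) (hω' : 2 * ω < 1 - 2 * r)
    (φ : ℕ+ → Signal) (hφ : Orthonormal ℝ φ)
    (κ : ℝ → ℕ → ℝ) (hκ : ∀ ε : ℝ, 0 < ε → Summable fun j : ℕ+ => κ ε j ^ 2)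
    (hA1 : CondA1 κ) (hA2 : CondA2 κ) (hA3 : CondA3 κ) (hA4 : CondA4 κ)
    (hk : (fun ε : ℝ => (kIndex κ ε : ℝ)) =Θ[𝓝[>] 0]
      fun ε : ℝ => ε ^ (-4 + 8 * r + 4 * ω))
    (S : ℝ → Signal)
    (hS : (fun ε : ℝ => ‖S ε‖) =Θ[𝓝[>] 0] fun ε : ℝ => ε ^ (2 * r)) :
    PurelyLDConsistent φ κ r ω S ↔
      ∀ (e : ℕ → ℝ) (S₁ : ℕ → Signal), (∀ i, 0 < e i) → Tendsto e atTop (𝓝 0) →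
        ((fun i => ‖S₁ i‖) =Θ[atTop] fun i => e i ^ (2 * r)) →
        LDInconsistent φ κ ω e S₁ →
        (fun i => ‖S (e i) + S₁ i‖ ^ 2 - (‖S (e i)‖ ^ 2 + ‖S₁ i‖ ^ 2))
          =o[atTop] fun i => e i ^ (4 * r) :=
  mainTheorem6_general hω (fun j => (hφ.1 j).le)
    (moderateWeights hω' hκ hA1 hA2 hA4.1.isBigO hk.isBigO_symm) hS
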